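/- Let $n\ge 1$ and let $\mathcal C_n=\{1<\cdots<n<\overline n<\cdots<\overline 1\}$. A column $C$ is a finite strictly increasing sequence of letters of $\mathcal C_n$, written from top to bottom. Let $z_1>\dots>z_r$ be the unbarred letters $z$ with $z,\overline z\in C$. The column $C$ is admissible if there are unbarred letters $t_1>\dots>t_r$ such that, for each $k$, $t_k$ is the greatest unbarred letter with $t_k<z_k$, $t_k<t_{k-1}$ (if $k\ge 2$), $t_k\notin C$ and $\overline{t_k}\notin C$. Then $rC$ (resp. $lC$) is the column obtained from $C$ by changing every $\overline{z_k}$ into $\overline{t_k}$ (resp. every $z_k$ into $t_k$) and reordering. For columns $C,C'$ write $C\le C'$ if $C$ is at least as high as $C'$ and the rows of $CC'$ weakly increase. Let $\lambda=\sum_{p=1}^n\lambda_p\Lambda_p$ with $\lambda_p\in\mathbb N$, and let $Y(\lambda)$ be the Young diagram with $\lambda_p$ columns of height $p$ for $p=1,\dots,n$. A symplectic tableau of shape $\lambda$ is a filling $T=C_1\cdots C_l$ of $Y(\lambda)$ whose columns $C_j$ are admissible and satisfy $rC_j\le lC_{j+1}$ for $1\le j<l$; the set of these is denoted $\mathbf{ST}(n,\lambda)$.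 The reading $\mathrm w(T)$ is the word obtained by reading the columns from right to left, each from top to bottom. A column of height $p$ is of highest weight if its letters are $1,\dots,p$, and $T_\lambda$ is the filling of $Y(\lambda)$ all of whose columns are of highest weight. A letter $x\neq 1$ of a column $C$ is movable if the predecessor of $x$ in $\mathcal C_n$ is not in $C$. For $1\le i<n$ let $M_i=\{\overline i,i+1\}$ and $P_i=\{\overline{i+1},i\}$, and let $M_n=\{\overline n\}$ and $P_n=\{n\}$. Let $T=C_1\cdots C_l\in\mathbf{ST}(n,\lambda)$ with $T\ne T_\lambda$. Let $C_k$ be the rightmost column of $T$ that is not of highest weight, $x$ the smallest movable letter of $C_k$, and $i\in\{1,\dots,n\}$ the index with $x\in M_i$. Let $y$ be the rightmost letter of $\mathrm w(T)$, at or after the occurrence of $x$ in $C_k$, such that $y\in M_i$ and the factor $x\cdots y$ of $\mathrm w(T)$ contains no letter of $P_i$. Let $r$ be the number of letters of $M_i$ in $x\cdots y$, and let $T_1$ be the filling of $Y(\lambda)$ obtained from $T$ by changing, in $x\cdots y$, each letter $\overline i$ into $\overline{i+1}$ and each letter $i+1$ into $i$ if $i\ne n$, and each letter $\overline n$ into $n$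 if $i=n$. Then $i$, $r$ and $T_1$ are well defined and uniquely determined by $T$, and $T_1\in\mathbf{ST}(n,\lambda)$. Consequently, for every $T\in\mathbf{ST}(n,\lambda)$, the algorithm that repeats this step until the tableau $T_\lambda$ is obtained is well defined and reaches $T_\lambda$ after finitely many steps; in particular it assigns to $T$ a unique finite sequence $(i_1,r_1),\dots,(i_s,r_s)$. -/

import Mathlib

namespace SymplecticTableaux

/-- The alphabet `1 < ⋯ < n < n̄ < ⋯ < 1̄`. The letters are numbered from `0`: the element
`j : Fin n` stands for the number `j + 1`. -/
inductive Letter (n : ℕ) : Type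
  | unbarred (j : Fin n) : Letter n
  | barred (j : Fin n) : Letter n

namespace Letter

variable {n : ℕ}

/-- Position of a letter in the alphabet, counted from `0`. -/
def rank : Letter n → ℕ
  | unbarred j => j.val
  | barred j => 2 * n - 1 - j.val

theorem rank_injective : Function.Injective (rank (n := n)) := by
  rintro (⟨a, ha⟩ | ⟨a, ha⟩) (⟨b, hb⟩ | ⟨b, hb⟩) h <;> simp only [rank] at h
  · subst h; rfl
  · omega
  · omega
  · have hab : a = b := by omega
    subst hab; rfl

instance : LinearOrder (Letter n) := LinearOrder.lift' rank rank_injective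

/-- The operator `ẽᵢ` on the crystal `1 → 2 → ⋯ → n → n̄ → ⋯ → 1̄` of the vector representation:
`i + 1 ↦ i`, `ī ↦ (i+1)‾` for `i < n`, and `n̄ ↦ n` for `i = n`; the value `none` is `0`. -/
def eTilde (i : Fin n) : Letter n → Option (Letter n)
  | unbarred j => if j.val = i.val + 1 then some (unbarred i) else none
  | barred j =>
      if j = i then
        if h : i.val + 1 < n then some (barred ⟨i.val + 1, h⟩) else some (unbarred i)
      else none

/-- The letter belongs to `{ī, i+1}` (to `{n̄}` if `i = n`). -/
def IsMinus (i : Fin n) : Letter n → Prop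
  | unbarred j => j.val = i.val + 1
  | barred j => j = i

/-- The letter belongs to `{(i+1)‾, i}` (to `{n}` if `i = n`). -/
def IsPlus (i : Fin n) : Letter n → Prop
  | unbarred j => j = i
  | barred j => j.val = i.val + 1

instance (i : Fin n) : DecidablePred (IsMinus i) := fun x =>
  match x with
  | unbarred j => inferInstanceAs (Decidable (j.val = i.val + 1))
  | barred j => inferInstanceAs (Decidable (j = i))

end Letter

open Letter

variable {n : ℕ}

/-- A column, as the list of its letters from top to bottom; this list is also its reading. -/
def IsColumn (C : List (Letter n)) : Prop := C.Pairwise (· < ·)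

/-- The unbarred letters `z₁ > ⋯ > z_r` such that the pair `(z, z̄)` occurs in `C`. -/
def pairLetters (C : List (Letter n)) : List (Fin n) :=
  (List.finRange n).reverse.filter fun z => unbarred z ∈ C ∧ barred z ∈ C

/-- `J` is the list `t₁ > ⋯ > t_r` attached to the column `C`: `t_k` is the greatest unbarred letter
with `t_k < z_k`, `t_k < t_{k-1}` (if `k` is not the first index) and neither `t_k` nor its barred
version in `C`. -/
def IsSplitList (C : List (Letter n)) (J : List (Fin n)) : Prop :=
  J.length = (pairLetters C).length ∧
    ∀ (k : ℕ) (hI : k < (pairLetters C).length) (hJ : k < J.length),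
      IsGreatest {t : Fin n | t < (pairLetters C)[k] ∧ (0 < k → t < J[k - 1]) ∧
        unbarred t ∉ C ∧ barred t ∉ C} J[k]

/-- Admissible columns. -/
def IsAdmissible (C : List (Letter n)) : Prop := IsColumn C ∧ ∃ J, IsSplitList C J

/-- The column `rC`: each `z̄_k` of a pair is changed into `t̄_k`. -/
def rightCol (C : List (Letter n)) (J : List (Fin n)) : List (Letter n) :=
  ((C.toFinset \ ((pairLetters C).map barred).toFinset) ∪ (J.map barred).toFinset).sort (· ≤ ·)

/-- The column `lC`: each `z_k` of a pair is changed into `t_k`. -/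
def leftCol (C : List (Letter n)) (J : List (Fin n)) : List (Letter n) :=
  ((C.toFinset \ ((pairLetters C).map unbarred).toFinset) ∪
    (J.map unbarred).toFinset).sort (· ≤ ·)

/-- `C₁ ≤ C₂`: the height of `C₁` is at least that of `C₂`, and the rows of `C₁C₂` weakly
increase. -/
def ColLE (C₁ C₂ : List (Letter n)) : Prop :=
  C₂.length ≤ C₁.length ∧
    ∀ (k : ℕ) (h₁ : k < C₁.length) (h₂ : k < C₂.length), C₁[k] ≤ C₂[k]

/-- `rC₁ ≤ lC₂` for admissible columns. -/
def SplitLE (C₁ C₂ : List (Letter n)) : Prop :=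
  ∃ J₁ J₂, IsSplitList C₁ J₁ ∧ IsSplitList C₂ J₂ ∧ ColLE (rightCol C₁ J₁) (leftCol C₂ J₂)

/-- A filling, as the list of its columns from left to right. -/
abbrev Filling (n : ℕ) : Type := List (List (Letter n))

/-- The reading: columns from right to left, each from top to bottom. -/
def reading (T : Filling n) : List (Letter n) := T.reverse.flatten

/-- Column heights, from left to right, of the Young diagram with `lam j` columns of height `j + 1`
(`j : Fin n`), i.e. of the dominant weight `∑ j, lam j • Λ_{j+1}`. -/
def heights (lam : Fin n → ℕ) : List ℕ :=
  (List.finRange n).reverse.flatMap fun j => List.replicate (lam j) (j.val + 1)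

/-- Symplectic tableaux of shape `lam`. -/
def IsSymplecticTableau (lam : Fin n → ℕ) (T : Filling n) : Prop :=
  T.map List.length = heights lam ∧ (∀ C ∈ T, IsAdmissible C) ∧ T.IsChain SplitLE

/-- The highest weight column of height `p` with letters `1, …, p` (for `p ≤ n`). -/
def highestCol (n p : ℕ) : List (Letter n) := ((List.finRange n).map unbarred).take p

/-- The tableau `T_λ`, all of whose columns are of highest weight. -/
def highestTableau (lam : Fin n → ℕ) : Filling n := (heights lam).map (highestCol n)

/-- A letter `x` of `C` is movable if it has a predecessor `pred x` in the alphabet, and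
`pred x ∉ C`. -/
def IsMovable (C : List (Letter n)) (x : Letter n) : Prop :=
  x ∈ C ∧ ∃ p, IsGreatest {y | y < x} p ∧ p ∉ C

/-- One step of the algorithm, leading from `T` to `T₁` with output `i` and `r`.
`k` is the (0-based) index of the rightmost column `C` of `T` that is not of highest weight, `x` is
the lowest movable letter of `C`, `a` is the position of this `x` in the word `w(T)`, and `b` is the
position of the letter `y`: the last letter of `w(T)` in `{ī, i+1}` such that the factor `x ⋯ y`
contains no letter of `{(i+1)‾, i}`. -/
def IsStep (T : Filling n) (i : Fin n) (r : ℕ) (T₁ : Filling n) : Prop :=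
  ∃ (k : ℕ) (C : List (Letter n)) (x : Letter n) (a b : ℕ),
    (T[k]? = some C ∧ C ≠ highestCol n C.length ∧
      ∀ D ∈ T.drop (k + 1), D = highestCol n D.length) ∧
    IsLeast {z | IsMovable C z} x ∧
    eTilde i x ≠ none ∧
    a = (reading (T.drop (k + 1))).length + C.idxOf x ∧
    IsGreatest {c | a ≤ c ∧ (∃ y, (reading T)[c]? = some y ∧ IsMinus i y) ∧
      ∀ d, a ≤ d → d ≤ c → ∀ z, (reading T)[d]? = some z → ¬ IsPlus i z} b ∧
    r = (((reading T).take (b + 1)).drop a).countP (fun z => IsMinus i z) ∧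
    T₁.map List.length = T.map List.length ∧
    reading T₁ = (reading T).mapIdx fun c z => if a ≤ c ∧ c ≤ b then (eTilde i z).getD z else z

/-- `IsRun lam T out`: the algorithm started at `T` reaches `T_λ` after finitely many steps, and
`out = [(i₁, r₁), …, (i_s, r_s)]` is its output. -/
inductive IsRun (lam : Fin n → ℕ) : Filling n → List (Fin n × ℕ) → Prop
  | done : IsRun lam (highestTableau lam) []
  | next {T T₁ : Filling n} {i : Fin n} {r : ℕ} {out : List (Fin n × ℕ)} :
      T ≠ highestTableau lam → IsStep T i r T₁ → IsRun lam T₁ out → IsRun lam T ((i, r) :: out)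

end SymplecticTableaux

/-!
The letters of `w(T)` before `x` are all smaller than `i`, as the letter `i` is neither in `C_k` nor
to the right of it. So one step lowers exactly those letters of `{ī, i+1}` that precede the first
letter of `{(i+1)‾, i}` in the word. This operation, `lowerPrefix i`, makes sense for every word,
and it preserves symplectic tableaux because it respects the split columns: `r(lowerPrefix i C)` is
`lowerPrefix i (rC)`, while `l(lowerPrefix i C)` is either `lowerPrefix i (lC)` or `lC` itself. The
letters `t_k` enter only through the number `pending C m` of letters `z_k ≥ m` not yet matched when
the greedy search has come down to `m`: `C` is admissible if and only if `pending C 0 = 0`, and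
`lowerPrefix i` changes `pending C m` only for `m = i + 1`. Each step decreases the sum of the ranks
of the letters, so the algorithm terminates.
-/

namespace SymplecticTableaux

open Letter

variable {n : ℕ}

namespace Letter

@[simp] theorem rank_unbarred (j : Fin n) : (unbarred j).rank = j.val := rfl

@[simp] theorem rank_barred (j : Fin n) : (barred j).rank = 2 * n - 1 - j.val := rfl

theorem lt_iff_rank_lt {x y : Letter n} : x < y ↔ x.rank < y.rank := Iff.rfl

theorem le_iff_rank_le {x y : Letter n} : x ≤ y ↔ x.rank ≤ y.rank := Iff.rfl

@[simp] theorem unbarred_lt_unbarred {j k : Fin n} : unbarred j < unbarred k ↔ j < k := Iff.rfl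

@[simp] theorem unbarred_lt_barred (j k : Fin n) : unbarred j < barred k := by
  rw [lt_iff_rank_lt, rank_unbarred, rank_barred]; omega

@[simp] theorem not_barred_lt_unbarred (j k : Fin n) : ¬ barred j < unbarred k :=
  (unbarred_lt_barred k j).not_gt

@[simp] theorem barred_lt_barred {j k : Fin n} : barred j < barred k ↔ k < j := by
  rw [lt_iff_rank_lt, rank_barred, rank_barred, Fin.lt_def]; omega

theorem rank_lt (x : Letter n) : x.rank < 2 * n := by
  rcases x with j | j <;> simp only [rank_unbarred, rank_barred] <;> omega

theorem exists_rank_eq {m : ℕ} (h : m < 2 * n) : ∃ x : Letter n, x.rank = m := by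
  by_cases hm : m < n
  · exact ⟨unbarred ⟨m, hm⟩, rfl⟩
  · exact ⟨barred ⟨2 * n - 1 - m, by omega⟩, by simp only [rank_barred]; omega⟩

theorem isGreatest_lt_iff {x q : Letter n} : IsGreatest {y | y < x} q ↔ q.rank + 1 = x.rank := by
  constructor
  · rintro ⟨hq, hmax⟩
    have hq : q.rank < x.rank := hq
    obtain ⟨y, hy⟩ := exists_rank_eq (n := n) (m := x.rank - 1) (by have := x.rank_lt; omega)
    have hyq := le_iff_rank_le.1 (hmax (lt_iff_rank_lt.2 (by omega) : y < x))
    omega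
  · intro h
    refine ⟨lt_iff_rank_lt.2 (by omega), fun y hy => le_iff_rank_le.2 ?_⟩
    have := lt_iff_rank_lt.1 hy
    omega

instance (i : Fin n) : DecidablePred (IsPlus i) := fun x =>
  match x with
  | unbarred j => inferInstanceAs (Decidable (j = i))
  | barred j => inferInstanceAs (Decidable (j.val = i.val + 1))

section Signature

variable {i j : Fin n} {x y z : Letter n}

@[simp] theorem isMinus_unbarred : IsMinus i (unbarred j) ↔ j.val = i.val + 1 := Iff.rfl

@[simp] theorem isMinus_barred : IsMinus i (barred j) ↔ j = i := Iff.rfl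

@[simp] theorem isPlus_unbarred : IsPlus i (unbarred j) ↔ j = i := Iff.rfl

@[simp] theorem isPlus_barred : IsPlus i (barred j) ↔ j.val = i.val + 1 := Iff.rfl

theorem isPlus_iff_of_succ (hij : j.val = i.val + 1) :
    IsPlus i z ↔ z = unbarred i ∨ z = barred j := by
  cases z <;> simp [Fin.ext_iff, hij]

theorem isMinus_iff_of_succ (hij : j.val = i.val + 1) :
    IsMinus i z ↔ z = unbarred j ∨ z = barred i := by
  cases z <;> simp [Fin.ext_iff, hij]

theorem isPlus_iff_of_last (hi : i.val + 1 = n) : IsPlus i z ↔ z = unbarred i := by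
  cases z <;> simp; omega

theorem isMinus_iff_of_last (hi : i.val + 1 = n) : IsMinus i z ↔ z = barred i := by
  cases z <;> simp; omega

theorem IsPlus.not_isMinus (h : IsPlus i z) : ¬ IsMinus i z := by
  cases z <;> simp only [isPlus_unbarred, isPlus_barred, isMinus_unbarred, isMinus_barred,
    Fin.ext_iff] at h ⊢ <;> omega

theorem IsMinus.index_unique (h : IsMinus i x) (h' : IsMinus j x) : i = j := by
  cases x <;> simp only [isMinus_unbarred, isMinus_barred, Fin.ext_iff] at h h' ⊢ <;> omega

theorem exists_isMinus (h : 0 < x.rank) : ∃ i, IsMinus i x := by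
  rcases x with j | j
  · rw [rank_unbarred] at h
    exact ⟨⟨j.val - 1, by omega⟩, by simp only [isMinus_unbarred]; omega⟩
  · exact ⟨j, rfl⟩

theorem IsPlus.le_rank (h : IsPlus i z) : i.val ≤ z.rank := by
  cases z <;> simp only [isPlus_unbarred, isPlus_barred, rank_unbarred, rank_barred,
    Fin.ext_iff] at h ⊢ <;> omega

theorem IsMinus.le_rank (h : IsMinus i z) : i.val ≤ z.rank := by
  cases z <;> simp only [isMinus_unbarred, isMinus_barred, rank_unbarred, rank_barred,
    Fin.ext_iff] at h ⊢ <;> omega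

theorem eTilde_ne_none_iff : eTilde i z ≠ none ↔ IsMinus i z := by
  cases z <;> simp only [eTilde, isMinus_unbarred, isMinus_barred] <;> split_ifs <;> simp_all

/-- The operator `ẽᵢ`, extended by the identity to the letters it kills. -/
def lower (i : Fin n) (z : Letter n) : Letter n := (eTilde i z).getD z

theorem lower_of_not_isMinus (h : ¬ IsMinus i z) : lower i z = z := by
  rw [lower, not_not.1 (mt eTilde_ne_none_iff.1 h), Option.getD_none]

theorem lower_unbarred_of_succ (hij : j.val = i.val + 1) : lower i (unbarred j) = unbarred i := by
  simp [lower, eTilde, hij]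

theorem lower_barred_of_succ (hij : j.val = i.val + 1) : lower i (barred i) = barred j := by
  have hi : i.val + 1 < n := hij ▸ j.isLt
  simp [lower, eTilde, hi, Fin.ext_iff, hij]

theorem lower_barred_of_last (hi : i.val + 1 = n) : lower i (barred i) = unbarred i := by
  simp [lower, eTilde, hi]

theorem exists_succ_or_last (i : Fin n) : (∃ j : Fin n, j.val = i.val + 1) ∨ i.val + 1 = n := by
  by_cases hi : i.val + 1 < n
  · exact Or.inl ⟨⟨i.val + 1, hi⟩, rfl⟩
  · exact Or.inr (by omega)

theorem IsMinus.isPlus_lower (h : IsMinus i z) : IsPlus i (lower i z) := by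
  obtain ⟨j, hij⟩ | hi := exists_succ_or_last i
  · obtain rfl | rfl := (isMinus_iff_of_succ hij).1 h
    · rw [lower_unbarred_of_succ hij, isPlus_unbarred]
    · rwa [lower_barred_of_succ hij, isPlus_barred]
  · obtain rfl := (isMinus_iff_of_last hi).1 h
    rw [lower_barred_of_last hi, isPlus_unbarred]

theorem IsMinus.rank_lower_add_one (h : IsMinus i z) : (lower i z).rank + 1 = z.rank := by
  obtain ⟨j, hij⟩ | hi := exists_succ_or_last i
  · obtain rfl | rfl := (isMinus_iff_of_succ hij).1 h
    · rw [lower_unbarred_of_succ hij, rank_unbarred, rank_unbarred, hij]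
    · rw [lower_barred_of_succ hij, rank_barred, rank_barred]; omega
  · obtain rfl := (isMinus_iff_of_last hi).1 h
    rw [lower_barred_of_last hi, rank_unbarred, rank_barred]; omega

theorem lower_le (i : Fin n) (z : Letter n) : lower i z ≤ z := by
  by_cases h : IsMinus i z
  · exact le_iff_rank_le.2 (Nat.le_of_succ_le h.rank_lower_add_one.le)
  · exact (lower_of_not_isMinus h).le

theorem IsMinus.le_lower (h : IsMinus i z) (hyz : y < z) : y ≤ lower i z := by
  have := h.rank_lower_add_one
  have := lt_iff_rank_lt.1 hyz
  exact le_iff_rank_le.2 (by omega)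

theorem lt_lower_of_not_isPlus (hy : ¬ IsPlus i y) (hyz : y < z) : y < lower i z := by
  by_cases hz : IsMinus i z
  · exact (hz.le_lower hyz).lt_of_ne fun h => hy (h ▸ hz.isPlus_lower)
  · rwa [lower_of_not_isMinus hz]

theorem IsPlus.eq_lower_or_pair (hy : IsPlus i y) (hz : IsMinus i z) (hyz : y < z) :
    y = lower i z ∨ y = unbarred i ∧ z = barred i := by
  obtain ⟨j, hij⟩ | hi := exists_succ_or_last i
  · rw [isPlus_iff_of_succ hij] at hy
    rw [isMinus_iff_of_succ hij] at hz
    obtain rfl | rfl := hy <;> obtain rfl | rfl := hz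
    · exact Or.inl (lower_unbarred_of_succ hij).symm
    · exact Or.inr ⟨rfl, rfl⟩
    · exact absurd hyz (not_barred_lt_unbarred j j)
    · exact Or.inl (lower_barred_of_succ hij).symm
  · exact Or.inr ⟨(isPlus_iff_of_last hi).1 hy, (isMinus_iff_of_last hi).1 hz⟩

end Signature

end Letter

/-- Lower, in the word `w`, all letters of `{ī, i+1}` that precede the first letter of
`{(i+1)‾, i}`. One step of the algorithm is this operation on the reading. -/
def lowerPrefix (i : Fin n) : List (Letter n) → List (Letter n)
  | [] => []
  | z :: w => if IsPlus i z then z :: w else lower i z :: lowerPrefix i w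

section LowerPrefix

variable {i : Fin n} {u w : List (Letter n)}

theorem lowerPrefix_cons_of_isPlus {z : Letter n} (h : IsPlus i z) :
    lowerPrefix i (z :: w) = z :: w := if_pos h

theorem lowerPrefix_cons_of_not_isPlus {z : Letter n} (h : ¬ IsPlus i z) :
    lowerPrefix i (z :: w) = lower i z :: lowerPrefix i w := if_neg h

@[simp] theorem length_lowerPrefix (i : Fin n) (w : List (Letter n)) :
    (lowerPrefix i w).length = w.length := by
  induction w with
  | nil => rfl
  | cons z w ih => rw [lowerPrefix]; split_ifs <;> simp [ih]

theorem lowerPrefix_append_of_exists (h : ∃ z ∈ u, IsPlus i z) (w : List (Letter n)) :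
    lowerPrefix i (u ++ w) = lowerPrefix i u ++ w := by
  induction u with
  | nil => simp at h
  | cons z u ih =>
    by_cases hz : IsPlus i z
    · simp only [List.cons_append, lowerPrefix_cons_of_isPlus hz]
    · simp only [List.cons_append, lowerPrefix_cons_of_not_isPlus hz]
      rw [ih (by simpa [hz] using h)]

theorem lowerPrefix_append_of_forall (h : ∀ z ∈ u, ¬ IsPlus i z) (w : List (Letter n)) :
    lowerPrefix i (u ++ w) = u.map (lower i) ++ lowerPrefix i w := by
  induction u with
  | nil => rfl
  | cons z u ih =>
    rw [List.forall_mem_cons] at h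
    rw [List.cons_append, lowerPrefix_cons_of_not_isPlus h.1, ih h.2, List.map_cons,
      List.cons_append]

theorem lowerPrefix_of_forall (h : ∀ z ∈ w, ¬ IsPlus i z) :
    lowerPrefix i w = w.map (lower i) := by
  simpa [lowerPrefix] using lowerPrefix_append_of_forall h []

theorem lowerPrefix_of_forall_not_isMinus (h : ∀ z ∈ w, ¬ IsMinus i z) :
    lowerPrefix i w = w := by
  induction w with
  | nil => rfl
  | cons z w ih =>
    rw [List.forall_mem_cons] at h
    rw [lowerPrefix, lower_of_not_isMinus h.1, ih h.2, ite_self]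

theorem lowerPrefix_le (i : Fin n) (w : List (Letter n)) :
    List.Forall₂ (· ≤ ·) (lowerPrefix i w) w := by
  induction w with
  | nil => exact .nil
  | cons z w ih =>
    by_cases hz : IsPlus i z
    · rw [lowerPrefix_cons_of_isPlus hz]
      exact List.forall₂_refl _
    · rw [lowerPrefix_cons_of_not_isPlus hz]
      exact .cons (lower_le i z) ih

theorem getElem?_lowerPrefix_of_forall {c : ℕ}
    (h : ∀ d ≤ c, ∀ z, w[d]? = some z → ¬ IsPlus i z) :
    (lowerPrefix i w)[c]? = w[c]?.map (lower i) := by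
  induction w generalizing c with
  | nil => rfl
  | cons y w ih =>
    rw [lowerPrefix_cons_of_not_isPlus (h 0 c.zero_le y rfl)]
    cases c with
    | zero => rfl
    | succ c => simpa using ih fun d hd z hz => h (d + 1) (by omega) z (by simpa using hz)

theorem getElem?_lowerPrefix_of_isPlus {c d : ℕ} (hdc : d ≤ c) {z : Letter n}
    (hz : w[d]? = some z) (h : IsPlus i z) : (lowerPrefix i w)[c]? = w[c]? := by
  induction w generalizing c d with
  | nil => simp at hz
  | cons y w ih =>
    by_cases hy : IsPlus i y
    · rw [lowerPrefix_cons_of_isPlus hy]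
    · rw [lowerPrefix_cons_of_not_isPlus hy]
      cases d with
      | zero => simp_all
      | succ d =>
        obtain ⟨c, rfl⟩ := Nat.exists_eq_succ_of_ne_zero (show c ≠ 0 by omega)
        simpa using ih (Nat.le_of_succ_le_succ hdc) (by simpa using hz)

end LowerPrefix

section Column

variable {i j : Fin n} {C D : List (Letter n)} {y : Letter n}

theorem IsColumn.eq_of_mem_iff (hC : IsColumn C) (hD : IsColumn D) (h : ∀ x, x ∈ C ↔ x ∈ D) :
    C = D :=
  ((List.perm_ext_iff_of_nodup (hC.imp ne_of_lt) (hD.imp ne_of_lt)).2 h).eq_of_pairwise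
    (fun _ _ _ _ h₁ h₂ => absurd h₁ h₂.asymm) hC hD

theorem lowerPrefix_eq_map (hC : IsColumn C) (i : Fin n) :
    lowerPrefix i C = C.map fun z => if ∃ p ∈ C, IsPlus i p ∧ p < z then z else lower i z := by
  induction C with
  | nil => rfl
  | cons z C ih =>
    obtain ⟨hz, hC⟩ := List.pairwise_cons.1 hC
    have hz_least : ¬ ∃ p ∈ z :: C, IsPlus i p ∧ p < z := by
      rintro ⟨p, hp, -, hlt⟩
      obtain rfl | hp := List.mem_cons.1 hp
      exacts [hlt.false, hlt.asymm (hz p hp)]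
    rw [List.map_cons, if_neg hz_least]
    by_cases hp : IsPlus i z
    · rw [lowerPrefix_cons_of_isPlus hp, lower_of_not_isMinus hp.not_isMinus]
      congr 1
      refine (List.map_id C).symm.trans (List.map_congr_left fun y hy => (if_pos ?_).symm)
      exact ⟨z, List.mem_cons_self, hp, hz y hy⟩
    · rw [lowerPrefix_cons_of_not_isPlus hp, ih hC]
      simp [hp]

theorem mem_lowerPrefix_iff (hC : IsColumn C) :
    y ∈ lowerPrefix i C ↔
      (y ∈ C ∧ (IsMinus i y → ∃ p ∈ C, IsPlus i p ∧ p < y)) ∨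
        ∃ z ∈ C, IsMinus i z ∧ lower i z = y ∧ ∀ p, IsPlus i p → p < z → p ∉ C := by
  rw [lowerPrefix_eq_map hC, List.mem_map]
  constructor
  · rintro ⟨z, hz, rfl⟩
    by_cases hm : IsMinus i z
    · split_ifs with hp
      · exact Or.inl ⟨hz, fun _ => hp⟩
      · exact Or.inr ⟨z, hz, hm, rfl, fun p h₁ h₂ h₃ => hp ⟨p, h₃, h₁, h₂⟩⟩
    · rw [lower_of_not_isMinus hm, ite_self]
      exact Or.inl ⟨hz, fun h => absurd h hm⟩
  · rintro (⟨hy, hp⟩ | ⟨z, hz, -, rfl, hp⟩)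
    · refine ⟨y, hy, ?_⟩
      by_cases hm : IsMinus i y
      · rw [if_pos (hp hm)]
      · rw [lower_of_not_isMinus hm, ite_self]
    · exact ⟨z, hz, if_neg fun ⟨p, h₁, h₂, h₃⟩ => hp p h₂ h₃ h₁⟩

theorem IsColumn.lowerPrefix (hC : IsColumn C) (i : Fin n) : IsColumn (lowerPrefix i C) := by
  induction C with
  | nil => exact hC
  | cons z C ih =>
    obtain ⟨hz, hC⟩ := List.pairwise_cons.1 hC
    by_cases hp : IsPlus i z
    · rw [lowerPrefix_cons_of_isPlus hp]
      exact List.pairwise_cons.2 ⟨hz, hC⟩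
    · rw [lowerPrefix_cons_of_not_isPlus hp]
      refine List.pairwise_cons.2 ⟨fun y hy => (lower_le i z).trans_lt ?_, ih hC⟩
      obtain ⟨hy, -⟩ | ⟨u, hu, -, rfl, -⟩ := (mem_lowerPrefix_iff hC).1 hy
      exacts [hz y hy, lt_lower_of_not_isPlus hp (hz u hu)]

theorem mem_lowerPrefix_of_neutral (hC : IsColumn C) (hp : ¬ IsPlus i y) (hm : ¬ IsMinus i y) :
    y ∈ lowerPrefix i C ↔ y ∈ C := by
  rw [mem_lowerPrefix_iff hC]
  constructor
  · rintro (h | ⟨z, -, hz, rfl, -⟩)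
    exacts [h.1, absurd hz.isPlus_lower hp]
  · exact fun h => Or.inl ⟨h, fun h' => absurd h' hm⟩

section Succ

variable (hC : IsColumn C) (hij : j.val = i.val + 1)
include hC hij

theorem unbarred_mem_lowerPrefix_of_succ :
    unbarred i ∈ lowerPrefix i C ↔ unbarred i ∈ C ∨ unbarred j ∈ C := by
  simp only [mem_lowerPrefix_iff hC, isPlus_iff_of_succ hij, isMinus_iff_of_succ hij]
  grind [lower_unbarred_of_succ, lower_barred_of_succ, unbarred_lt_unbarred, barred_lt_barred,
    unbarred_lt_barred, not_barred_lt_unbarred]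

theorem unbarred_succ_mem_lowerPrefix_of_succ :
    unbarred j ∈ lowerPrefix i C ↔ unbarred j ∈ C ∧ unbarred i ∈ C := by
  simp only [mem_lowerPrefix_iff hC, isPlus_iff_of_succ hij, isMinus_iff_of_succ hij]
  grind [lower_unbarred_of_succ, lower_barred_of_succ, unbarred_lt_unbarred, barred_lt_barred,
    unbarred_lt_barred, not_barred_lt_unbarred]

theorem barred_succ_mem_lowerPrefix_of_succ :
    barred j ∈ lowerPrefix i C ↔ barred j ∈ C ∨ barred i ∈ C ∧ unbarred i ∉ C := by
  simp only [mem_lowerPrefix_iff hC, isPlus_iff_of_succ hij, isMinus_iff_of_succ hij]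
  grind [lower_unbarred_of_succ, lower_barred_of_succ, unbarred_lt_unbarred, barred_lt_barred,
    unbarred_lt_barred, not_barred_lt_unbarred]

theorem barred_mem_lowerPrefix_of_succ :
    barred i ∈ lowerPrefix i C ↔ barred i ∈ C ∧ (unbarred i ∈ C ∨ barred j ∈ C) := by
  simp only [mem_lowerPrefix_iff hC, isPlus_iff_of_succ hij, isMinus_iff_of_succ hij]
  grind [lower_unbarred_of_succ, lower_barred_of_succ, unbarred_lt_unbarred, barred_lt_barred,
    unbarred_lt_barred, not_barred_lt_unbarred]

end Succ

section Last

variable (hC : IsColumn C) (hi : i.val + 1 = n)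
include hC hi

theorem unbarred_mem_lowerPrefix_of_last :
    unbarred i ∈ lowerPrefix i C ↔ unbarred i ∈ C ∨ barred i ∈ C := by
  simp only [mem_lowerPrefix_iff hC, isPlus_iff_of_last hi, isMinus_iff_of_last hi]
  grind [lower_barred_of_last, unbarred_lt_barred]

theorem barred_mem_lowerPrefix_of_last :
    barred i ∈ lowerPrefix i C ↔ barred i ∈ C ∧ unbarred i ∈ C := by
  simp only [mem_lowerPrefix_iff hC, isPlus_iff_of_last hi, isMinus_iff_of_last hi]
  grind [lower_barred_of_last, unbarred_lt_barred]

end Last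

section ColLE

theorem ColLE.lowerPrefix_left (h : ColLE C D) (i : Fin n) : ColLE (lowerPrefix i C) D := by
  refine ⟨by simpa using h.1, fun k h₁ h₂ => ?_⟩
  have hk : k < C.length := by simpa using h₁
  exact ((lowerPrefix_le i C).get h₁ hk).trans (h.2 k hk h₂)

/-- The critical case is `C[k] = D[k]` in `{ī, i+1}`, where `C[k]` is kept because of a letter
`C[m]` of `{(i+1)‾, i}` above it. As `C` has no pair, `C[m]` is the predecessor of `C[k]`, and
hence so is `D[m]`. -/
theorem ColLE.lowerPrefix (h : ColLE C D) (hC : IsColumn C) (hD : IsColumn D)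
    (hD_plus : ∀ p ∈ D, ¬ IsPlus i p) (hC_pair : unbarred i ∈ C → barred i ∉ C) :
    ColLE (lowerPrefix i C) (lowerPrefix i D) := by
  refine ⟨by simpa using h.1, fun k h₁ h₂ => ?_⟩
  have hkC : k < C.length := by simpa using h₁
  have hkD : k < D.length := by simpa using h₂
  have hle : (SymplecticTableaux.lowerPrefix i C)[k] ≤ D[k] := (h.lowerPrefix_left i).2 k h₁ hkD
  simp only [lowerPrefix_of_forall hD_plus, List.getElem_map]
  by_cases hm : IsMinus i D[k]
  swap
  · rwa [lower_of_not_isMinus hm]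
  refine hm.le_lower (hle.lt_of_ne fun heq => ?_)
  have hCD : C[k] = D[k] := (h.2 k hkC hkD).antisymm
    (heq ▸ (lowerPrefix_le i C).get h₁ hkC)
  obtain ⟨-, hp⟩ | ⟨z, -, hz, hzD, -⟩ := (mem_lowerPrefix_iff hC).1 (heq ▸ List.getElem_mem h₁)
  swap
  · exact (hzD ▸ hz.isPlus_lower).not_isMinus hm
  obtain ⟨p, hpC, hp, hlt⟩ := hp hm
  obtain ⟨m, hmC, rfl⟩ := List.getElem_of_mem hpC
  have hmk : m < k := hC.sortedLT.getElem_lt_getElem_iff.1 (hlt.trans_eq hCD.symm)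
  have hmD : m < D.length := hmk.trans hkD
  obtain hpred | ⟨hu, hb⟩ := hp.eq_lower_or_pair hm hlt
  · have hDm : D[m] = lower i D[k] :=
      (hm.le_lower (hD.sortedLT.getElem_lt_getElem_iff.2 hmk)).antisymm (hpred ▸ h.2 m hmC hmD)
    exact hD_plus _ (List.getElem_mem _) (hDm ▸ hm.isPlus_lower)
  · exact hC_pair (hu ▸ hpC) (hb ▸ hCD ▸ List.getElem_mem hkC)

end ColLE

end Column

section CountGE

/-- The number of entries of `L` that are at least `m`. -/
def countGE (L : List (Fin n)) (m : ℕ) : ℕ := L.countP fun s => m ≤ s.val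

variable {L : List (Fin n)} {k m : ℕ}

theorem countGE_zero (L : List (Fin n)) : countGE L 0 = L.length := by simp [countGE]

theorem countGE_of_le (L : List (Fin n)) (hm : n ≤ m) : countGE L m = 0 :=
  List.countP_eq_zero.2 fun s _ => by simpa using s.isLt.trans_le hm

theorem countGE_eq_add_count (L : List (Fin n)) (k : Fin n) :
    countGE L k = countGE L (k + 1) + L.count k := by
  induction L with
  | nil => rfl
  | cons a L ih =>
    simp only [countGE, List.countP_cons, List.count_cons, decide_eq_true_eq, beq_iff_eq,
      Fin.ext_iff] at ih ⊢
    split_ifs <;> omega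

theorem lt_countGE_iff (hL : L.SortedGT) (hk : k < L.length) :
    k < countGE L m ↔ m ≤ L[k].val := by
  induction L generalizing k with
  | nil => simp at hk
  | cons a L ih =>
    obtain ⟨ha, hL⟩ := List.pairwise_cons.1 hL.pairwise
    rw [countGE, List.countP_cons, ← countGE]
    cases k with
    | zero =>
      have hpos : 0 < countGE L m → m ≤ a.val := fun h => by
        obtain ⟨s, hs, hms⟩ := List.countP_pos_iff.1 h
        exact (of_decide_eq_true hms).trans (ha s hs).le
      rw [List.getElem_cons_zero]
      split_ifs with hm <;> simp only [decide_eq_true_eq] at hm <;> omega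
    | succ k =>
      have hkL : k < L.length := by simpa using hk
      have hlt : L[k].val < a.val := ha _ (List.getElem_mem hkL)
      have := ih hL.sortedGT hkL
      rw [List.getElem_cons_succ]
      split_ifs with hm <;> simp only [decide_eq_true_eq] at hm <;> omega

end CountGE

theorem descending_induction {P : ℕ → Prop} (of_le : ∀ m, n ≤ m → P m)
    (of_succ : ∀ k : Fin n, P (k + 1) → P k) (m : ℕ) : P m := by
  obtain hm | hm := le_or_gt n m
  · exact of_le m hm
  · exact Nat.decreasingInduction (motive := fun m _ => P m) (fun k hk => of_succ ⟨k, hk⟩)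
      (of_le n le_rfl) hm.le

section Split

/-- The number of letters `z_k ≥ m` of `C` (in a pair) for which no letter `t_k ≥ m` has been found
when the free letters are searched greedily from the top. The truncated subtraction is intended:
a free letter is skipped when there is nothing to match. -/
def pending (C : List (Letter n)) (m : ℕ) : ℕ :=
  if h : m < n then
    if unbarred ⟨m, h⟩ ∈ C then
      if barred ⟨m, h⟩ ∈ C then pending C (m + 1) + 1 else pending C (m + 1)
    else
      if barred ⟨m, h⟩ ∈ C then pending C (m + 1) else pending C (m + 1) - 1
  else 0
termination_by n - m

/-- The letters `t₁ > ⋯ > t_r` of an admissible column `C`. For an arbitrary column, the greedy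
search may find too few letters. -/
def splitLetters (C : List (Letter n)) : List (Fin n) :=
  (List.finRange n).reverse.filter fun t =>
    unbarred t ∉ C ∧ barred t ∉ C ∧ 0 < pending C (t.val + 1)

variable {C : List (Letter n)} {J J' : List (Fin n)} {k : Fin n} {m : ℕ}

theorem pending_of_le (C : List (Letter n)) (hm : n ≤ m) : pending C m = 0 := by
  rw [pending, dif_neg hm.not_gt]

theorem pending_eq (C : List (Letter n)) (k : Fin n) :
    pending C k =
      if unbarred k ∈ C then
        if barred k ∈ C then pending C (k + 1) + 1 else pending C (k + 1)
      else
        if barred k ∈ C then pending C (k + 1) else pending C (k + 1) - 1 := by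
  rw [pending, dif_pos k.isLt]

theorem mem_pairLetters : k ∈ pairLetters C ↔ unbarred k ∈ C ∧ barred k ∈ C := by
  simp [pairLetters]

theorem mem_splitLetters :
    k ∈ splitLetters C ↔ unbarred k ∉ C ∧ barred k ∉ C ∧ 0 < pending C (k + 1) := by
  simp [splitLetters]

theorem sortedGT_pairLetters (C : List (Letter n)) : (pairLetters C).SortedGT :=
  ((List.sortedLT_finRange n).reverse.pairwise.filter _).sortedGT

theorem sortedGT_splitLetters (C : List (Letter n)) : (splitLetters C).SortedGT :=
  ((List.sortedLT_finRange n).reverse.pairwise.filter _).sortedGT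

theorem countGE_pairLetters (C : List (Letter n)) (m : ℕ) :
    countGE (pairLetters C) m = countGE (splitLetters C) m + pending C m := by
  induction m using descending_induction (n := n) with
  | of_le m hm => simp only [countGE_of_le _ hm, pending_of_le C hm]
  | of_succ k ih =>
    have hZ := (sortedGT_pairLetters C).nodup
    have hS := (sortedGT_splitLetters C).nodup
    rw [countGE_eq_add_count, countGE_eq_add_count, hZ.count, hS.count, pending_eq, ih]
    grind [mem_pairLetters, mem_splitLetters]

theorem IsSplitList.sortedGT (h : IsSplitList C J) : J.SortedGT := by
  rw [List.sortedGT_iff_pairwise, ← List.isChain_iff_pairwise, List.isChain_iff_getElem]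
  intro k hk
  exact (h.2 (k + 1) (h.1 ▸ hk) hk).1.2.1 k.succ_pos

theorem IsSplitList.unique (h : IsSplitList C J) (h' : IsSplitList C J') : J = J' := by
  refine List.ext_getElem (h.1.trans h'.1.symm) fun k => ?_
  induction k with
  | zero =>
    intro hJ hJ'
    have hk := h.2 0 (h.1 ▸ hJ) hJ
    have hk' := h'.2 0 (h.1 ▸ hJ) hJ'
    simp only [lt_irrefl, false_imp_iff, true_and] at hk hk'
    exact hk.unique hk'
  | succ k ih =>
    intro hJ hJ'
    have hk := h.2 (k + 1) (h.1 ▸ hJ) hJ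
    have hk' := h'.2 (k + 1) (h.1 ▸ hJ) hJ'
    simp only [Nat.add_sub_cancel] at hk hk'
    rw [ih (by omega) (by omega)] at hk
    exact hk.unique hk'

theorem isSplitList_splitLetters (h : pending C 0 = 0) : IsSplitList C (splitLetters C) := by
  have hS := sortedGT_splitLetters C
  have hZ := sortedGT_pairLetters C
  have hlen : (splitLetters C).length = (pairLetters C).length := by
    rw [← countGE_zero, ← countGE_zero, countGE_pairLetters, h, add_zero]
  refine ⟨hlen, fun k hkZ hkS => ?_⟩
  obtain ⟨hu, hb, hpos⟩ := mem_splitLetters.1 (List.getElem_mem hkS)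
  refine ⟨⟨?_, fun hk0 => ?_, hu, hb⟩, fun t ⟨htZ, htS, htu, htb⟩ => le_of_not_gt fun hlt => ?_⟩
  · have hcount := countGE_pairLetters C ((splitLetters C)[k].val + 1)
    have hle : k ≤ countGE (splitLetters C) ((splitLetters C)[k].val + 1) := by
      have := (lt_countGE_iff (m := (splitLetters C)[k].val) hS hkS).2 le_rfl
      rw [countGE_eq_add_count, hS.nodup.count, if_pos (List.getElem_mem hkS)] at this
      omega
    exact (lt_countGE_iff hZ hkZ).1 (show k < countGE _ ((splitLetters C)[k].val + 1) by omega)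
  · exact hS.getElem_gt_getElem_of_lt (show k - 1 < k by omega)
  · have ht_skipped : t ∉ splitLetters C := fun ht => by
      obtain ⟨l, hl, rfl⟩ := List.getElem_of_mem ht
      have hlk : l < k := hS.getElem_lt_getElem_iff.1 hlt
      have hkl : k - 1 < l := hS.getElem_lt_getElem_iff.1 (htS (by omega))
      omega
    have hcount := countGE_pairLetters C (t.val + 1)
    have hpending : pending C (t.val + 1) = 0 := by
      simpa [mem_splitLetters, htu, htb] using ht_skipped
    have hkZ' := (lt_countGE_iff (m := t.val + 1) hZ hkZ).2 htZ
    have := (lt_countGE_iff (m := t.val + 1) hS hkS).1 (by omega)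
    exact absurd hlt (by rw [Fin.lt_def]; omega)

theorem IsSplitList.countGE_le (h : IsSplitList C J) (m : ℕ) :
    countGE J m ≤ countGE (pairLetters C) m := by
  by_contra! hlt
  have hkJ : countGE (pairLetters C) m < J.length := hlt.trans_le List.countP_le_length
  have hkZ : countGE (pairLetters C) m < (pairLetters C).length := h.1 ▸ hkJ
  have hmJ := (lt_countGE_iff h.sortedGT hkJ).1 hlt
  have hJZ := (h.2 _ hkZ hkJ).1.1
  exact lt_irrefl _ ((lt_countGE_iff (sortedGT_pairLetters C) hkZ).2
    (hmJ.trans (Fin.le_def.1 hJZ.le)))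

theorem IsSplitList.countGE_le_splitLetters (h : IsSplitList C J) (m : ℕ) :
    countGE J m ≤ countGE (splitLetters C) m := by
  induction m using descending_induction (n := n) with
  | of_le m hm => simp only [countGE_of_le _ hm, le_refl]
  | of_succ k ih =>
    by_cases hk : k ∈ J
    swap
    · rw [countGE_eq_add_count J, countGE_eq_add_count, List.count_eq_zero.2 hk]
      omega
    obtain ⟨l, hl, rfl⟩ := List.getElem_of_mem hk
    obtain ⟨-, -, hu, hb⟩ := (h.2 l (h.1 ▸ hl) hl).1
    obtain h0 | hpos := Nat.eq_zero_or_pos (pending C (J[l].val + 1))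
    · refine (h.countGE_le _).trans_eq ?_
      rw [countGE_pairLetters, pending_eq, if_neg hu, if_neg hb, h0, Nat.zero_sub, add_zero]
    · have hS : 0 < (splitLetters C).count J[l] :=
        List.count_pos_iff.2 (mem_splitLetters.2 ⟨hu, hb, hpos⟩)
      rw [countGE_eq_add_count J, countGE_eq_add_count (splitLetters C), h.sortedGT.nodup.count,
        if_pos hk]
      omega

theorem isSplitList_iff : IsSplitList C J ↔ pending C 0 = 0 ∧ J = splitLetters C := by
  constructor
  · intro h
    have hpending : pending C 0 = 0 := by
      have := h.countGE_le_splitLetters 0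
      have hZ := countGE_pairLetters C 0
      simp only [countGE_zero, h.1] at this hZ
      omega
    exact ⟨hpending, h.unique (isSplitList_splitLetters hpending)⟩
  · rintro ⟨h, rfl⟩
    exact isSplitList_splitLetters h

theorem isAdmissible_iff : IsAdmissible C ↔ IsColumn C ∧ pending C 0 = 0 := by
  simp [IsAdmissible, isSplitList_iff]

end Split

/-- The column `rC` of an admissible column `C`. -/
def splitRight (C : List (Letter n)) : List (Letter n) := rightCol C (splitLetters C)

/-- The column `lC` of an admissible column `C`. -/
def splitLeft (C : List (Letter n)) : List (Letter n) := leftCol C (splitLetters C)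

section SplitColumns

variable {C D : List (Letter n)} {i j k : Fin n} {z : Letter n} {m : ℕ}

theorem splitLE_iff :
    SplitLE C D ↔ pending C 0 = 0 ∧ pending D 0 = 0 ∧ ColLE (splitRight C) (splitLeft D) := by
  simp only [SplitLE, isSplitList_iff, splitRight, splitLeft]
  grind

theorem isColumn_splitRight (C : List (Letter n)) : IsColumn (splitRight C) := by
  rw [IsColumn, splitRight, rightCol]
  exact (Finset.sortedLT_sort _).pairwise

theorem isColumn_splitLeft (C : List (Letter n)) : IsColumn (splitLeft C) := by
  rw [IsColumn, splitLeft, leftCol]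
  exact (Finset.sortedLT_sort _).pairwise

theorem unbarred_mem_splitRight : unbarred k ∈ splitRight C ↔ unbarred k ∈ C := by
  simp [splitRight, rightCol]

theorem barred_mem_splitRight :
    barred k ∈ splitRight C ↔ unbarred k ∉ C ∧ (barred k ∈ C ∨ 0 < pending C (k + 1)) := by
  simp only [splitRight, rightCol, Finset.mem_sort, Finset.mem_union, Finset.mem_sdiff,
    List.mem_toFinset, List.mem_map, barred.injEq, exists_eq_right, mem_pairLetters,
    mem_splitLetters]
  tauto

theorem barred_mem_splitLeft : barred k ∈ splitLeft C ↔ barred k ∈ C := by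
  simp [splitLeft, leftCol]

theorem unbarred_mem_splitLeft :
    unbarred k ∈ splitLeft C ↔ barred k ∉ C ∧ (unbarred k ∈ C ∨ 0 < pending C (k + 1)) := by
  simp only [splitLeft, leftCol, Finset.mem_sort, Finset.mem_union, Finset.mem_sdiff,
    List.mem_toFinset, List.mem_map, unbarred.injEq, exists_eq_right, mem_pairLetters,
    mem_splitLetters]
  tauto

theorem unbarred_mem_lowerPrefix_of_ne (hC : IsColumn C) (hi : k ≠ i) (hj : k.val ≠ i.val + 1) :
    unbarred k ∈ lowerPrefix i C ↔ unbarred k ∈ C :=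
  mem_lowerPrefix_of_neutral hC hi hj

theorem barred_mem_lowerPrefix_of_ne (hC : IsColumn C) (hi : k ≠ i) (hj : k.val ≠ i.val + 1) :
    barred k ∈ lowerPrefix i C ↔ barred k ∈ C :=
  mem_lowerPrefix_of_neutral hC hj hi

theorem pending_lowerPrefix (hC : IsColumn C) (hm : m ≠ i.val + 1) :
    pending (lowerPrefix i C) m = pending C m := by
  suffices ∀ m' ≥ m, m' ≠ i.val + 1 → pending (lowerPrefix i C) m' = pending C m' from
    this m le_rfl hm
  clear hm
  induction m using descending_induction (n := n) with
  | of_le m hm =>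
    intro m' hm' _
    rw [pending_of_le _ (hm.trans hm'), pending_of_le _ (hm.trans hm')]
  | of_succ k ih =>
    intro m' hm' hne
    obtain hlt | rfl := hm'.lt_or_eq
    · exact ih m' hlt hne
    rw [pending_eq, pending_eq]
    obtain rfl | hki := eq_or_ne k i
    · obtain ⟨j, hij⟩ | hi := exists_succ_or_last k
      · rw [← hij, pending_eq, pending_eq, ih (j + 1) (by omega) (by omega)]
        grind [unbarred_mem_lowerPrefix_of_succ, unbarred_succ_mem_lowerPrefix_of_succ,
          barred_mem_lowerPrefix_of_succ, barred_succ_mem_lowerPrefix_of_succ]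
      · rw [pending_of_le _ hi.ge, pending_of_le _ hi.ge]
        grind [unbarred_mem_lowerPrefix_of_last, barred_mem_lowerPrefix_of_last]
    · rw [ih (k + 1) le_rfl (by omega)]
      simp only [unbarred_mem_lowerPrefix_of_ne hC hki hne, barred_mem_lowerPrefix_of_ne hC hki hne]

theorem mem_splitRight_lowerPrefix_of_neutral (hC : IsColumn C) (hp : ¬ IsPlus i z)
    (hm : ¬ IsMinus i z) : z ∈ splitRight (lowerPrefix i C) ↔ z ∈ splitRight C := by
  cases z with
  | unbarred k =>
    rw [unbarred_mem_splitRight, unbarred_mem_splitRight, mem_lowerPrefix_of_neutral hC hp hm]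
  | barred k =>
    rw [isPlus_barred] at hp
    rw [isMinus_barred] at hm
    rw [barred_mem_splitRight, barred_mem_splitRight, unbarred_mem_lowerPrefix_of_ne hC hm hp,
      barred_mem_lowerPrefix_of_ne hC hm hp, pending_lowerPrefix hC (by omega)]

theorem mem_splitLeft_lowerPrefix_of_neutral (hC : IsColumn C) (hp : ¬ IsPlus i z)
    (hm : ¬ IsMinus i z) : z ∈ splitLeft (lowerPrefix i C) ↔ z ∈ splitLeft C := by
  cases z with
  | unbarred k =>
    rw [isPlus_unbarred] at hp
    rw [isMinus_unbarred] at hm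
    rw [unbarred_mem_splitLeft, unbarred_mem_splitLeft, unbarred_mem_lowerPrefix_of_ne hC hp hm,
      barred_mem_lowerPrefix_of_ne hC hp hm, pending_lowerPrefix hC (by omega)]
  | barred k =>
    rw [barred_mem_splitLeft, barred_mem_splitLeft, mem_lowerPrefix_of_neutral hC hp hm]

theorem splitRight_lowerPrefix (hC : IsColumn C) (i : Fin n) :
    splitRight (lowerPrefix i C) = lowerPrefix i (splitRight C) := by
  have hR := isColumn_splitRight C
  refine (isColumn_splitRight _).eq_of_mem_iff (hR.lowerPrefix i) fun z => ?_
  by_cases hz : IsPlus i z ∨ IsMinus i z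
  swap
  · obtain ⟨hp, hm⟩ := not_or.1 hz
    rw [mem_splitRight_lowerPrefix_of_neutral hC hp hm, mem_lowerPrefix_of_neutral hR hp hm]
  obtain ⟨j, hij⟩ | hi := exists_succ_or_last i
  · have hpending := pending_lowerPrefix (i := i) (m := j + 1) hC (by omega)
    rw [isPlus_iff_of_succ hij, isMinus_iff_of_succ hij] at hz
    grind [unbarred_mem_lowerPrefix_of_succ, unbarred_succ_mem_lowerPrefix_of_succ,
      barred_mem_lowerPrefix_of_succ, barred_succ_mem_lowerPrefix_of_succ, unbarred_mem_splitRight,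
      barred_mem_splitRight, pending_eq]
  · rw [isPlus_iff_of_last hi, isMinus_iff_of_last hi] at hz
    have hpending (C : List (Letter n)) := pending_of_le C hi.ge
    grind [unbarred_mem_lowerPrefix_of_last, barred_mem_lowerPrefix_of_last,
      unbarred_mem_splitRight, barred_mem_splitRight]

theorem splitLeft_lowerPrefix_of_isPlus (hC : IsColumn C)
    (h : ∃ p, IsPlus i p ∧ (p ∈ C ∨ p ∈ splitLeft C)) :
    splitLeft (lowerPrefix i C) = splitLeft C := by
  refine (isColumn_splitLeft _).eq_of_mem_iff (isColumn_splitLeft C) fun z => ?_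
  by_cases hz : IsPlus i z ∨ IsMinus i z
  swap
  · obtain ⟨hp, hm⟩ := not_or.1 hz
    exact mem_splitLeft_lowerPrefix_of_neutral hC hp hm
  obtain ⟨j, hij⟩ | hi := exists_succ_or_last i
  · have hpending := pending_lowerPrefix (i := i) (m := j + 1) hC (by omega)
    rw [isPlus_iff_of_succ hij, isMinus_iff_of_succ hij] at hz
    simp only [isPlus_iff_of_succ hij] at h
    grind [unbarred_mem_lowerPrefix_of_succ, unbarred_succ_mem_lowerPrefix_of_succ,
      barred_mem_lowerPrefix_of_succ, barred_succ_mem_lowerPrefix_of_succ, unbarred_mem_splitLeft,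
      barred_mem_splitLeft, pending_eq]
  · rw [isPlus_iff_of_last hi, isMinus_iff_of_last hi] at hz
    simp only [isPlus_iff_of_last hi] at h
    have hpending (C : List (Letter n)) := pending_of_le C hi.ge
    grind [unbarred_mem_lowerPrefix_of_last, barred_mem_lowerPrefix_of_last,
      unbarred_mem_splitLeft, barred_mem_splitLeft]

theorem splitLeft_lowerPrefix_of_isMinus (hC : IsColumn C)
    (h : ∀ p, IsPlus i p → p ∉ C ∧ p ∉ splitLeft C) (hm : ∃ y ∈ C, IsMinus i y) :
    splitLeft (lowerPrefix i C) = lowerPrefix i (splitLeft C) := by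
  have hL := isColumn_splitLeft C
  refine (isColumn_splitLeft _).eq_of_mem_iff (hL.lowerPrefix i) fun z => ?_
  by_cases hz : IsPlus i z ∨ IsMinus i z
  swap
  · obtain ⟨hp, hm⟩ := not_or.1 hz
    rw [mem_splitLeft_lowerPrefix_of_neutral hC hp hm, mem_lowerPrefix_of_neutral hL hp hm]
  obtain ⟨j, hij⟩ | hi := exists_succ_or_last i
  · have hpending := pending_lowerPrefix (i := i) (m := j + 1) hC (by omega)
    rw [isPlus_iff_of_succ hij, isMinus_iff_of_succ hij] at hz
    simp only [isPlus_iff_of_succ hij] at h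
    simp only [isMinus_iff_of_succ hij] at hm
    grind [unbarred_mem_lowerPrefix_of_succ, unbarred_succ_mem_lowerPrefix_of_succ,
      barred_mem_lowerPrefix_of_succ, barred_succ_mem_lowerPrefix_of_succ, unbarred_mem_splitLeft,
      barred_mem_splitLeft, pending_eq]
  · rw [isPlus_iff_of_last hi, isMinus_iff_of_last hi] at hz
    simp only [isPlus_iff_of_last hi] at h
    simp only [isMinus_iff_of_last hi] at hm
    grind [unbarred_mem_lowerPrefix_of_last, barred_mem_lowerPrefix_of_last,
      unbarred_mem_splitLeft, barred_mem_splitLeft]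

theorem IsAdmissible.lowerPrefix (hC : IsAdmissible C) (i : Fin n) :
    IsAdmissible (lowerPrefix i C) := by
  rw [isAdmissible_iff] at hC ⊢
  exact ⟨hC.1.lowerPrefix i, (pending_lowerPrefix hC.1 (by omega)).trans hC.2⟩

theorem SplitLE.lowerPrefix (h : SplitLE C D) (hC : IsColumn C) (hD : IsColumn D)
    (i : Fin n) : SplitLE (lowerPrefix i C) (lowerPrefix i D) := by
  rw [splitLE_iff] at h ⊢
  obtain ⟨hC0, hD0, hCD⟩ := h
  refine ⟨(pending_lowerPrefix hC (by omega)).trans hC0,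
    (pending_lowerPrefix hD (by omega)).trans hD0, ?_⟩
  rw [splitRight_lowerPrefix hC]
  by_cases hp : ∃ p, IsPlus i p ∧ (p ∈ D ∨ p ∈ splitLeft D)
  · rw [splitLeft_lowerPrefix_of_isPlus hD hp]
    exact hCD.lowerPrefix_left i
  by_cases hm : ∃ y ∈ D, IsMinus i y
  · push Not at hp
    rw [splitLeft_lowerPrefix_of_isMinus hD hp hm]
    refine hCD.lowerPrefix (isColumn_splitRight C) (isColumn_splitLeft D)
      (fun p hpD hpp => (hp p hpp).2 hpD) fun hu hb => ?_
    exact (barred_mem_splitRight.1 hb).1 (unbarred_mem_splitRight.1 hu)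
  · push Not at hm
    rw [lowerPrefix_of_forall_not_isMinus hm]
    exact hCD.lowerPrefix_left i

theorem SplitLE.lowerPrefix_right (h : SplitLE C D) (hD : IsColumn D)
    (hD_plus : ∃ p ∈ D, IsPlus i p) : SplitLE C (SymplecticTableaux.lowerPrefix i D) := by
  rw [splitLE_iff] at h ⊢
  obtain ⟨hC0, hD0, hCD⟩ := h
  obtain ⟨p, hpD, hp⟩ := hD_plus
  refine ⟨hC0, (pending_lowerPrefix hD (by omega)).trans hD0, ?_⟩
  rwa [splitLeft_lowerPrefix_of_isPlus hD ⟨p, hp, Or.inl hpD⟩]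

end SplitColumns

/-- The operation `lowerPrefix i` on the concatenation of the words of `R`, keeping the division
into words. -/
def lowerCols (i : Fin n) : List (List (Letter n)) → List (List (Letter n))
  | [] => []
  | C :: R => lowerPrefix i C :: if ∃ z ∈ C, IsPlus i z then R else lowerCols i R

/-- The filling with the shape of `T` and with reading `lowerPrefix i (reading T)`. -/
def lowerTableau (i : Fin n) (T : Filling n) : Filling n := (lowerCols i T.reverse).reverse

section LowerTableau

variable {R : List (List (Letter n))} {T T' : Filling n} {lam : Fin n → ℕ}

theorem flatten_lowerCols (i : Fin n) (R : List (List (Letter n))) :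
    (lowerCols i R).flatten = lowerPrefix i R.flatten := by
  induction R with
  | nil => rfl
  | cons C R ih =>
    rw [lowerCols, List.flatten_cons, List.flatten_cons]
    split_ifs with h
    · rw [lowerPrefix_append_of_exists h]
    · push Not at h
      rw [ih, lowerPrefix_append_of_forall h, lowerPrefix_of_forall h]

theorem map_length_lowerCols (i : Fin n) (R : List (List (Letter n))) :
    (lowerCols i R).map List.length = R.map List.length := by
  induction R with
  | nil => rfl
  | cons C R ih => rw [lowerCols]; split_ifs <;> simp [ih]

theorem isAdmissible_of_mem_lowerCols (i : Fin n) (hR : ∀ C ∈ R, IsAdmissible C) :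
    ∀ C ∈ lowerCols i R, IsAdmissible C := by
  induction R with
  | nil => exact hR
  | cons C R ih =>
    rw [List.forall_mem_cons] at hR
    rw [lowerCols, List.forall_mem_cons]
    refine ⟨hR.1.lowerPrefix i, ?_⟩
    split_ifs
    exacts [hR.2, ih hR.2]

theorem isChain_lowerCols (i : Fin n) (hR : ∀ C ∈ R, IsColumn C)
    (hchain : R.IsChain fun D C => SplitLE C D) :
    (lowerCols i R).IsChain fun D C => SplitLE C D := by
  induction R with
  | nil => exact hchain
  | cons D R ih =>
    rw [List.forall_mem_cons] at hR
    cases R with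
    | nil => simp [lowerCols]
    | cons C R =>
      rw [List.isChain_cons_cons] at hchain
      rw [lowerCols]
      split_ifs with hD
      · exact List.isChain_cons_cons.2 ⟨hchain.1.lowerPrefix_right hR.1 hD, hchain.2⟩
      · have hC := hR.2 C List.mem_cons_self
        exact List.isChain_cons_cons.2 ⟨hchain.1.lowerPrefix hC hR.1 i, ih hR.2 hchain.2⟩

theorem reading_lowerTableau (i : Fin n) (T : Filling n) :
    reading (lowerTableau i T) = lowerPrefix i (reading T) := by
  rw [reading, lowerTableau, List.reverse_reverse, flatten_lowerCols, reading]

theorem map_length_lowerTableau (i : Fin n) (T : Filling n) :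
    (lowerTableau i T).map List.length = T.map List.length := by
  rw [lowerTableau, List.map_reverse, map_length_lowerCols, List.map_reverse, List.reverse_reverse]

theorem IsSymplecticTableau.lowerTableau (hT : IsSymplecticTableau lam T) (i : Fin n) :
    IsSymplecticTableau lam (lowerTableau i T) := by
  obtain ⟨hshape, hadm, hchain⟩ := hT
  have hadm' : ∀ C ∈ T.reverse, IsAdmissible C := fun C hC => hadm C (List.mem_reverse.1 hC)
  refine ⟨(map_length_lowerTableau i T).trans hshape, fun C hC => ?_, List.isChain_reverse.2 ?_⟩
  · exact isAdmissible_of_mem_lowerCols i hadm' C (List.mem_reverse.1 hC)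
  · exact isChain_lowerCols i (fun C hC => (hadm' C hC).1) (List.isChain_reverse.2 hchain)

theorem eq_of_reading_eq (h : reading T = reading T')
    (hshape : T.map List.length = T'.map List.length) : T = T' :=
  List.reverse_injective (List.eq_iff_flatten_eq.2
    ⟨h, by rw [List.map_reverse, List.map_reverse, hshape]⟩)

end LowerTableau

section HighestColumn

variable {C : List (Letter n)} {x y z : Letter n} {i : Fin n} {p : ℕ}

theorem length_highestCol (n p : ℕ) : (highestCol n p).length = min p n := by
  simp [highestCol]

theorem rank_getElem_highestCol {k : ℕ} (hk : k < (highestCol n p).length) :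
    ((highestCol n p)[k]).rank = k := by
  simp [highestCol]

theorem mem_highestCol_iff : z ∈ highestCol n p ↔ z.rank < min p n := by
  rw [← length_highestCol]
  constructor
  · intro hz
    obtain ⟨k, hk, rfl⟩ := List.getElem_of_mem hz
    rwa [rank_getElem_highestCol]
  · intro hz
    rw [← rank_injective (rank_getElem_highestCol hz)]
    exact List.getElem_mem hz

theorem isColumn_highestCol (n p : ℕ) : IsColumn (highestCol n p) :=
  List.pairwise_iff_getElem.2 fun a b ha hb hab => by
    rwa [lt_iff_rank_lt, rank_getElem_highestCol ha, rank_getElem_highestCol hb]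

theorem IsColumn.le_rank (hC : IsColumn C) {k : ℕ} (hk : k < C.length) : k ≤ C[k].rank := by
  induction k with
  | zero => exact Nat.zero_le _
  | succ k ih =>
    exact (ih (Nat.lt_of_succ_lt hk)).trans_lt
      (lt_iff_rank_lt.1 (hC.sortedLT.getElem_lt_getElem_iff.2 k.lt_succ_self))

theorem isMovable_iff : IsMovable C x ↔ x ∈ C ∧ ∃ q : Letter n, q.rank + 1 = x.rank ∧ q ∉ C := by
  simp only [IsMovable, isGreatest_lt_iff]

theorem finite_setOf_isMovable (C : List (Letter n)) : {z | IsMovable C z}.Finite :=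
  C.toFinset.finite_toSet.subset fun z hz => by simpa using hz.1

theorem mem_of_forall_not_isMovable {y : Letter n} (hy : y ∈ C)
    (hmov : ∀ w ≤ y, ¬ IsMovable C w) (hzy : z ≤ y) : z ∈ C := by
  obtain heq | hlt := (le_iff_rank_le.1 hzy).eq_or_lt
  · rwa [rank_injective heq]
  obtain ⟨q, hq⟩ := exists_rank_eq (n := n) (m := y.rank - 1) (by have := y.rank_lt; omega)
  have hqC : q ∈ C := by
    by_contra hqC
    exact hmov y le_rfl (isMovable_iff.2 ⟨hy, q, by omega, hqC⟩)
  have hqy : q ≤ y := le_iff_rank_le.2 (by omega)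
  exact mem_of_forall_not_isMovable hqC (fun w hw => hmov w (hw.trans hqy))
    (le_iff_rank_le.2 (by omega))
termination_by y.rank

theorem IsColumn.eq_highestCol (hC : IsColumn C) (hn : C.length ≤ n)
    (hmov : ∀ z, ¬ IsMovable C z) : C = highestCol n C.length := by
  have hrank : ∀ k, ∀ hk : k < C.length, C[k].rank = k := by
    intro k
    induction k using Nat.strong_induction_on with
    | _ k ih =>
      intro hk
      have hle := hC.le_rank hk
      by_contra hne
      obtain ⟨q, hq⟩ := exists_rank_eq (n := n) (m := k) (by omega)
      have hqk : q < C[k] := lt_iff_rank_lt.2 (by omega)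
      have hqC := mem_of_forall_not_isMovable (List.getElem_mem hk) (fun w _ => hmov w) hqk.le
      obtain ⟨m, hm, rfl⟩ := List.getElem_of_mem hqC
      have hmk : m < k := hC.sortedLT.getElem_lt_getElem_iff.1 hqk
      have := ih m hmk hm
      omega
  refine List.ext_getElem (by rw [length_highestCol, min_eq_left hn]) fun k hk hk' => ?_
  exact rank_injective ((hrank k hk).trans (rank_getElem_highestCol hk').symm)

theorem IsColumn.exists_isLeast_isMovable (hC : IsColumn C) (hn : C.length ≤ n)
    (hne : C ≠ highestCol n C.length) : ∃ x, IsLeast {z | IsMovable C z} x := by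
  have hmov : {z | IsMovable C z}.Nonempty := by
    by_contra hempty
    exact hne (hC.eq_highestCol hn fun z hz => hempty ⟨z, hz⟩)
  obtain ⟨x, hx, hmin⟩ := Set.exists_min_image _ id (finite_setOf_isMovable C) hmov
  exact ⟨x, hx, hmin⟩

theorem mem_of_le_of_lt_isLeast (hx : IsLeast {z | IsMovable C z} x) (hy : y ∈ C) (hyx : y < x)
    (hzy : z ≤ y) : z ∈ C :=
  mem_of_forall_not_isMovable hy (fun _ hw hmov => (hx.2 hmov).not_gt (hw.trans_lt hyx)) hzy

/-- If `x = ī` and `i ∈ C`, then `C` contains all letters `t < i`, so that no `t_k` is left for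
`z_k = i`. -/
theorem IsAdmissible.unbarred_notMem (hC : IsAdmissible C) (hx : IsLeast {z | IsMovable C z} x)
    (hi : IsMinus i x) : unbarred i ∉ C := by
  intro hiC
  cases x with
  | unbarred j =>
    obtain ⟨-, q, hq, hqC⟩ := isMovable_iff.1 hx.1
    have hqi : q.rank = (unbarred i).rank := Nat.succ_injective (hq.trans hi)
    exact hqC (rank_injective hqi ▸ hiC)
  | barred j =>
    obtain rfl := isMinus_barred.1 hi
    obtain ⟨-, J, hlen, hJ⟩ := hC
    obtain ⟨k, hk, hkj⟩ := List.getElem_of_mem (mem_pairLetters.2 ⟨hiC, hx.1.1⟩)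
    obtain ⟨⟨hlt, -, hfree, -⟩, -⟩ := hJ k hk (hlen ▸ hk)
    exact hfree (mem_of_le_of_lt_isLeast hx hiC (unbarred_lt_barred j j) (hkj ▸ hlt.le))

theorem splitLeft_eq_self (hC : IsColumn C) (hbar : ∀ k, barred k ∉ C) : splitLeft C = C := by
  have hpair : pairLetters C = [] :=
    List.eq_nil_iff_forall_not_mem.2 fun k hk => hbar k (mem_pairLetters.1 hk).2
  have hsplit : splitLetters C = [] := by
    have hcount := countGE_pairLetters C 0
    rw [countGE_zero, countGE_zero, hpair, List.length_nil] at hcount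
    exact List.length_eq_zero_iff.1 (by omega)
  refine (isColumn_splitLeft C).eq_of_mem_iff hC fun x => ?_
  simp [splitLeft, leftCol, hpair, hsplit]

theorem SplitLE.unbarred_mem (h : SplitLE C (highestCol n p)) (hi : unbarred i ∈ highestCol n p) :
    unbarred i ∈ C := by
  have hbar : ∀ k, barred k ∉ highestCol n p := fun k hk => by
    rw [mem_highestCol_iff, rank_barred] at hk
    omega
  obtain ⟨-, -, hlen, hle⟩ := splitLE_iff.1 h
  simp only [splitLeft_eq_self (isColumn_highestCol n p) hbar] at hlen hle
  have hi_lt : i.val < (highestCol n p).length := by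
    simpa [length_highestCol] using mem_highestCol_iff.1 hi
  have hiR := hi_lt.trans_le hlen
  have hrank_le : (splitRight C)[i.val].rank ≤ i.val :=
    (le_iff_rank_le.1 (hle i hiR hi_lt)).trans_eq (rank_getElem_highestCol hi_lt)
  have hRi : (splitRight C)[i.val] = unbarred i :=
    rank_injective (hrank_le.antisymm ((isColumn_splitRight C).le_rank hiR))
  exact unbarred_mem_splitRight.1 (hRi ▸ List.getElem_mem hiR)

theorem not_isPlus_and_not_isMinus_of_mem_highestCol (hi : unbarred i ∉ highestCol n p)
    (hz : z ∈ highestCol n p) : ¬ IsPlus i z ∧ ¬ IsMinus i z := by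
  rw [mem_highestCol_iff] at hi hz
  have hlt : z.rank < i.val := hz.trans_le (not_lt.1 hi)
  exact ⟨fun h => hlt.not_ge h.le_rank, fun h => hlt.not_ge h.le_rank⟩

end HighestColumn

section Step

variable {lam : Fin n → ℕ} {T T₁ T₂ : Filling n} {C : List (Letter n)} {w u v : List (Letter n)}
  {x : Letter n} {i j : Fin n} {r s k a b : ℕ}

theorem isGreatest_setOf_getElem?_iff {α : Type*} {P : α → Prop} {L : List α} :
    IsGreatest {k | ∃ c, L[k]? = some c ∧ ¬ P c} k ↔
      ∃ c, L[k]? = some c ∧ ¬ P c ∧ ∀ d ∈ L.drop (k + 1), P d := by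
  constructor
  · rintro ⟨⟨c, hc, hPc⟩, hmax⟩
    refine ⟨c, hc, hPc, fun d hd => by_contra fun hPd => ?_⟩
    obtain ⟨m, hm⟩ := List.mem_iff_getElem?.1 hd
    rw [List.getElem?_drop] at hm
    have : k + 1 + m ≤ k := hmax ⟨d, hm, hPd⟩
    omega
  · rintro ⟨c, hc, hPc, hdrop⟩
    refine ⟨⟨c, hc, hPc⟩, fun m ⟨d, hd, hPd⟩ => not_lt.1 fun hkm => hPd (hdrop d ?_)⟩
    refine List.mem_iff_getElem?.2 ⟨m - (k + 1), ?_⟩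
    rwa [List.getElem?_drop, Nat.add_sub_cancel' hkm]

/-- The positions in `w` of the candidates for the letter `y`, when `x` has position `a`. -/
def factorEnds (i : Fin n) (w : List (Letter n)) (a : ℕ) : Set ℕ :=
  {c | a ≤ c ∧ (∃ y, w[c]? = some y ∧ IsMinus i y) ∧
    ∀ d, a ≤ d → d ≤ c → ∀ z, w[d]? = some z → ¬ IsPlus i z}

theorem exists_isGreatest_factorEnds (hx : w[a]? = some x) (hi : IsMinus i x) :
    ∃ b, IsGreatest (factorEnds i w a) b := by
  have hbdd : BddAbove (factorEnds i w a) := by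
    refine ⟨w.length, ?_⟩
    rintro c ⟨-, ⟨y, hy, -⟩, -⟩
    exact (List.getElem?_eq_some_iff.1 hy).1.le
  refine hbdd.exists_isGreatest_of_nonempty ⟨a, le_rfl, ⟨x, hx, hi⟩, fun d had hda z hz hplus => ?_⟩
  obtain rfl := had.antisymm hda
  obtain rfl := Option.some_injective _ (hz.symm.trans hx)
  exact hplus.not_isMinus hi

theorem mapIdx_eq_lowerPrefix (hu : ∀ z ∈ u, ¬ IsPlus i z ∧ ¬ IsMinus i z)
    (hb : IsGreatest (factorEnds i (u ++ v) u.length) b) :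
    ((u ++ v).mapIdx fun c z => if u.length ≤ c ∧ c ≤ b then (eTilde i z).getD z else z) =
      lowerPrefix i (u ++ v) := by
  have hmem {d : ℕ} {z : Letter n} (hd : d < u.length) (hz : (u ++ v)[d]? = some z) : z ∈ u :=
    List.mem_of_getElem? (List.getElem?_append_left hd ▸ hz)
  refine List.ext_getElem? fun c => ?_
  rw [List.getElem?_mapIdx]
  by_cases hplus : ∃ d ≤ c, ∃ p, (u ++ v)[d]? = some p ∧ IsPlus i p
  · obtain ⟨d, hdc, p, hp, hpp⟩ := hplus
    have hd : u.length ≤ d := not_lt.1 fun hd => (hu p (hmem hd hp)).1 hpp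
    have hcb : ¬ (u.length ≤ c ∧ c ≤ b) := fun h => hb.1.2.2 d hd (hdc.trans h.2) p hp hpp
    simp only [if_neg hcb, Option.map_id', getElem?_lowerPrefix_of_isPlus hdc hp hpp]
  · push Not at hplus
    rw [getElem?_lowerPrefix_of_forall hplus]
    refine Option.map_congr fun z hz => ?_
    change (if u.length ≤ c ∧ c ≤ b then lower i z else z) = lower i z
    by_cases hm : IsMinus i z
    · have hc : u.length ≤ c := not_lt.1 fun hc => (hu z (hmem hc hz)).2 hm
      exact if_pos ⟨hc, hb.2 ⟨hc, ⟨z, hz, hm⟩, fun d _ => hplus d⟩⟩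
    · rw [lower_of_not_isMinus hm, ite_self]

theorem sum_rank_lowerPrefix_lt
    (hu : ∀ z ∈ u, ¬ IsPlus i z) (hx : IsMinus i x) :
    ((lowerPrefix i (u ++ x :: v)).map rank).sum < ((u ++ x :: v).map rank).sum := by
  have hu_le : ((u.map (lower i)).map rank).sum ≤ (u.map rank).sum := by
    rw [List.map_map]
    exact List.sum_le_sum fun z _ => le_iff_rank_le.1 (lower_le i z)
  have hv_le : ((lowerPrefix i v).map rank).sum ≤ (v.map rank).sum := by
    refine List.Forall₂.sum_le_sum (List.forall₂_map_left_iff.2 (List.forall₂_map_right_iff.2 ?_))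
    exact (lowerPrefix_le i v).imp fun _ _ => le_iff_rank_le.1
  have hx_lt := hx.rank_lower_add_one
  rw [lowerPrefix_append_of_forall hu, lowerPrefix_cons_of_not_isPlus fun h => h.not_isMinus hx]
  simp only [List.map_append, List.map_cons, List.sum_append, List.sum_cons]
  omega

theorem unbarred_notMem_of_isChain (h : (C :: T).IsChain SplitLE) (hC : unbarred i ∉ C)
    (hT : ∀ D ∈ T, D = highestCol n D.length) : ∀ D ∈ T, unbarred i ∉ D := by
  induction T generalizing C with
  | nil => simp
  | cons D T ih =>
    rw [List.isChain_cons_cons] at h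
    rw [List.forall_mem_cons] at hT
    have hD : unbarred i ∉ D := by
      obtain ⟨hCD, -⟩ := h
      rw [hT.1] at hCD ⊢
      exact mt hCD.unbarred_mem hC
    exact List.forall_mem_cons.2 ⟨hD, ih h.2 hD hT.2⟩

theorem reading_eq_append (hk : T[k]? = some C) :
    reading T = reading (T.drop (k + 1)) ++ (C ++ reading (T.take k)) := by
  obtain ⟨hlt, rfl⟩ := List.getElem?_eq_some_iff.1 hk
  have hT : T = T.take k ++ T[k] :: T.drop (k + 1) := by simp
  refine (congrArg reading hT).trans ?_
  simp only [reading, List.reverse_append, List.reverse_cons, List.append_assoc,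
    List.singleton_append, List.flatten_append, List.flatten_cons]

/-- All letters of `w(T)` before `x` are smaller than `i`: the letter `i` is not in `C_k`, and
therefore in no column to the right of it. -/
theorem IsSymplecticTableau.exists_reading_eq_append (hT : IsSymplecticTableau lam T)
    (hk : T[k]? = some C) (hright : ∀ D ∈ T.drop (k + 1), D = highestCol n D.length)
    (hx : IsLeast {z | IsMovable C z} x) (hi : IsMinus i x) :
    ∃ u v, reading T = u ++ x :: v ∧
      u.length = (reading (T.drop (k + 1))).length + C.idxOf x ∧
      ∀ z ∈ u, ¬ IsPlus i z ∧ ¬ IsMinus i z := by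
  obtain ⟨-, hadm, hchain⟩ := hT
  have hC := hadm C (List.mem_of_getElem? hk)
  have hiC : unbarred i ∉ C := hC.unbarred_notMem hx hi
  have hi_right : ∀ D ∈ T.drop (k + 1), unbarred i ∉ D := by
    obtain ⟨hlt, rfl⟩ := List.getElem?_eq_some_iff.1 hk
    refine unbarred_notMem_of_isChain ?_ hiC hright
    rw [List.cons_getElem_drop_succ]
    exact hchain.drop k
  obtain ⟨s, t, rfl⟩ := List.append_of_mem hx.1.1
  have hs : ∀ z ∈ s, z < x := fun z hz => (List.pairwise_append.1 hC.1).2.2 z hz x (by simp)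
  refine ⟨reading (T.drop (k + 1)) ++ s, t ++ reading (T.take k), ?_, ?_, fun z hz => ?_⟩
  · simp [reading_eq_append hk]
  · rw [List.length_append, List.idxOf_append_of_notMem fun hxs => (hs x hxs).false]
    simp
  obtain hz | hz := List.mem_append.1 hz
  · simp only [reading, List.mem_flatten, List.mem_reverse] at hz
    obtain ⟨D, hD, hzD⟩ := hz
    have hiD := hi_right D hD
    rw [hright D hD] at hiD hzD
    exact not_isPlus_and_not_isMinus_of_mem_highestCol hiD hzD
  · have hiz : ¬ unbarred i ≤ z := fun h =>
      hiC (mem_of_le_of_lt_isLeast hx (List.mem_append_left _ hz) (hs z hz) h)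
    exact ⟨fun h => hiz h.le_rank, fun h => hiz h.le_rank⟩

theorem IsStep.eq_lowerTableau (h : IsStep T i r T₁) (hT : IsSymplecticTableau lam T) :
    T₁ = lowerTableau i T := by
  obtain ⟨k, C, x, a, b, ⟨hk, -, hright⟩, hx, he, rfl, hb, -, hshape, hread⟩ := h
  obtain ⟨u, v, huv, hu_length, hu⟩ :=
    hT.exists_reading_eq_append hk hright hx (eTilde_ne_none_iff.1 he)
  rw [← hu_length, huv] at hb hread
  rw [mapIdx_eq_lowerPrefix hu hb, ← huv, ← reading_lowerTableau] at hread
  exact eq_of_reading_eq hread (hshape.trans (map_length_lowerTableau i T).symm)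

theorem IsStep.isSymplecticTableau (h : IsStep T i r T₁) (hT : IsSymplecticTableau lam T) :
    IsSymplecticTableau lam T₁ :=
  h.eq_lowerTableau hT ▸ hT.lowerTableau i

theorem IsStep.sum_rank_lt (h : IsStep T i r T₁) (hT : IsSymplecticTableau lam T) :
    ((reading T₁).map rank).sum < ((reading T).map rank).sum := by
  rw [h.eq_lowerTableau hT, reading_lowerTableau]
  obtain ⟨k, C, x, a, b, ⟨hk, -, hright⟩, hx, he, -⟩ := h
  have hi := eTilde_ne_none_iff.1 he
  obtain ⟨u, v, huv, -, hu⟩ := hT.exists_reading_eq_append hk hright hx hi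
  rw [huv]
  exact sum_rank_lowerPrefix_lt (fun z hz => (hu z hz).1) hi

theorem IsStep.unique (h : IsStep T i r T₁) (h' : IsStep T j s T₂)
    (hT : IsSymplecticTableau lam T) : (i, r, T₁) = (j, s, T₂) := by
  have hT₁ := h.eq_lowerTableau hT
  have hT₂ := h'.eq_lowerTableau hT
  obtain ⟨k, C, x, a, b, hk, hx, he, rfl, hb, rfl, -⟩ := h
  obtain ⟨k', C', x', a', b', hk', hx', he', rfl, hb', rfl, -⟩ := h'
  obtain rfl : k = k' :=
    (isGreatest_setOf_getElem?_iff (P := fun D => D = highestCol n D.length).2 ⟨C, hk⟩).unique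
      (isGreatest_setOf_getElem?_iff.2 ⟨C', hk'⟩)
  obtain rfl := Option.some_injective _ (hk.1.symm.trans hk'.1)
  obtain rfl := hx.unique hx'
  obtain rfl := (eTilde_ne_none_iff.1 he).index_unique (eTilde_ne_none_iff.1 he')
  obtain rfl := hb.unique hb'
  rw [hT₁, hT₂]

theorem IsSymplecticTableau.length_le (hT : IsSymplecticTableau lam T) (hC : C ∈ T) :
    C.length ≤ n := by
  have hmem : C.length ∈ heights lam := hT.1 ▸ List.mem_map_of_mem hC
  simp only [heights, List.mem_flatMap, List.mem_replicate] at hmem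
  obtain ⟨j, -, -, hj⟩ := hmem
  omega

theorem IsSymplecticTableau.exists_rightmost_ne_highestCol (hT : IsSymplecticTableau lam T)
    (hne : T ≠ highestTableau lam) :
    ∃ k C, T[k]? = some C ∧ C ≠ highestCol n C.length ∧
      ∀ D ∈ T.drop (k + 1), D = highestCol n D.length := by
  have hnonempty : {k : ℕ | ∃ C, T[k]? = some C ∧ C ≠ highestCol n C.length}.Nonempty := by
    by_contra! hempty
    refine hne ?_
    rw [highestTableau, ← hT.1, List.map_map]
    refine (List.map_id T).symm.trans (List.map_congr_left fun C hC => by_contra fun hC_ne => ?_)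
    obtain ⟨k, hk⟩ := List.mem_iff_getElem?.1 hC
    exact (Set.eq_empty_iff_forall_notMem.1 hempty) k ⟨C, hk, hC_ne⟩
  have hbdd : BddAbove {k : ℕ | ∃ C, T[k]? = some C ∧ C ≠ highestCol n C.length} := by
    refine ⟨T.length, ?_⟩
    rintro k ⟨C, hk, -⟩
    exact (List.getElem?_eq_some_iff.1 hk).1.le
  obtain ⟨k, hk⟩ := hbdd.exists_isGreatest_of_nonempty hnonempty
  exact ⟨k, isGreatest_setOf_getElem?_iff.1 hk⟩

theorem IsSymplecticTableau.exists_isStep (hT : IsSymplecticTableau lam T)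
    (hne : T ≠ highestTableau lam) : ∃ i r T₁, IsStep T i r T₁ := by
  obtain ⟨k, C, hk, hC_ne, hright⟩ := hT.exists_rightmost_ne_highestCol hne
  have hCT : C ∈ T := List.mem_of_getElem? hk
  obtain ⟨x, hx⟩ := (hT.2.1 C hCT).1.exists_isLeast_isMovable (hT.length_le hCT) hC_ne
  obtain ⟨-, q, hq, -⟩ := isMovable_iff.1 hx.1
  obtain ⟨i, hi⟩ := exists_isMinus (x := x) (by omega)
  obtain ⟨u, v, huv, hu_length, hu⟩ := hT.exists_reading_eq_append hk hright hx hi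
  obtain ⟨b, hb⟩ :=
    exists_isGreatest_factorEnds (w := u ++ x :: v) (a := u.length) (by simp) hi
  refine ⟨i, _, SymplecticTableaux.lowerTableau i T, k, C, x, u.length, b, ⟨hk, hC_ne, hright⟩, hx,
    eTilde_ne_none_iff.2 hi, hu_length, huv ▸ hb, rfl, map_length_lowerTableau i T, ?_⟩
  rw [reading_lowerTableau, huv, mapIdx_eq_lowerPrefix hu hb]

theorem IsSymplecticTableau.exists_isRun {T : Filling n} (hT : IsSymplecticTableau lam T) :
    ∃ out, IsRun lam T out := by
  by_cases hne : T = highestTableau lam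
  · exact ⟨[], hne ▸ .done⟩
  obtain ⟨i, r, T₁, h⟩ := hT.exists_isStep hne
  obtain ⟨out, hout⟩ := exists_isRun (h.isSymplecticTableau hT)
  exact ⟨(i, r) :: out, .next hne h hout⟩
termination_by ((reading T).map rank).sum
decreasing_by exact h.sum_rank_lt hT

theorem IsRun.unique {out out' : List (Fin n × ℕ)} (h : IsRun lam T out) (h' : IsRun lam T out')
    (hT : IsSymplecticTableau lam T) : out = out' := by
  induction h generalizing out' with
  | done =>
    cases h' with
    | done => rfl
    | next hne => exact absurd rfl hne
  | next hne hstep _ ih =>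
    cases h' with
    | done => exact absurd rfl hne
    | next _ hstep' hrun' =>
      cases hstep.unique hstep' hT
      rw [ih hrun' (hstep.isSymplecticTableau hT)]

end Step

end SymplecticTableaux

theorem mainTheorem4 (n : ℕ) (lam : Fin n → ℕ) (T : SymplecticTableaux.Filling n)
    (hT : SymplecticTableaux.IsSymplecticTableau lam T) :
    (T ≠ SymplecticTableaux.highestTableau lam →
      (∃! p : Fin n × ℕ × SymplecticTableaux.Filling n,
        SymplecticTableaux.IsStep T p.1 p.2.1 p.2.2) ∧
      ∀ (i : Fin n) (r : ℕ) (T₁ : SymplecticTableaux.Filling n),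
        SymplecticTableaux.IsStep T i r T₁ → SymplecticTableaux.IsSymplecticTableau lam T₁) ∧
    ∃! out : List (Fin n × ℕ), SymplecticTableaux.IsRun lam T out := by
  refine ⟨fun hne => ⟨?_, fun i r T₁ h => h.isSymplecticTableau hT⟩, ?_⟩
  · obtain ⟨i, r, T₁, h⟩ := hT.exists_isStep hne
    exact ⟨(i, r, T₁), h, fun p h' => h'.unique h hT⟩
  · obtain ⟨out, h⟩ := hT.exists_isRun
    exact ⟨out, h, fun out' h' => h'.unique h hT⟩
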